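/- Let $\mathcal A$ be an abelian category with enough projective objects. All subcategories are full and closed under isomorphism. A subcategory $\mathcal F$ of $\mathcal A$ is called resolving if it contains all projective objects, is closed under direct summands, and for every exact sequence $0\to L\to M\to N\to 0$ in $\mathcal A$ with $N\in\mathcal F$ one has $L\in\mathcal F$ if and only if $M\in\mathcal F$; for a subcategory $\mathcal C$, $\operatorname{res}\mathcal C$ denotes the smallest resolving subcategory containing $\mathcal C$. For $d\ge 0$, a $d$-th syzygy of $M\in\mathcal A$ is an object $X$ admitting an exact sequence $0\to X\to P_{d-1}\to\cdots\to P_0\to M\to 0$ with all $P_i$ projective (so $X\cong M$ if $d=0$), and $\Omega^d\mathcal A$ denotes the subcategory of all $d$-th syzygies of objects of $\mathcal A$. For a subcategory $\mathcal X$ of a triangulated category $\mathcal T$, let $\operatorname{add}\mathcal X$ be the smallest subcategory containing $\mathcal X$ and closed under finite direct sums and direct summands, let $\langle\mathcal X\rangle=\operatorname{add}\{X[i]\mid X\in\mathcal X,\ i\in\mathbb Z\}$, and for $n\ge1$ let $\langle\mathcal X\rangle_n=\operatorname{add}(\langle\mathcal X\rangle*\cdots*\langle\mathcal X\rangle)$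 ($n$ factors), where $\mathcal X*\mathcal Y$ consists of the objects $M$ admitting an exact triangle $X\to M\to Y\to X[1]$ with $X\in\mathcal X$ and $Y\in\mathcal Y$. The dimension of $\mathcal T$ with respect to $\mathcal X$ is $\inf\{n\ge0\mid \mathcal T=\langle\mathcal X\rangle_{n+1}\}\in\mathbb N\cup\{\infty\}$. Regard $\mathcal A$ as the subcategory of complexes concentrated in degree $0$ in the bounded derived category $\mathsf D^{\mathrm b}(\mathcal A)$. **Theorem.** Let $d\ge 0$. 1. Let $\mathcal F$ be a resolving subcategory of $\mathcal A$, and let $M\in\mathsf D^{\mathrm b}(\mathcal A)$ be such that for every $i\in\mathbb Z$ some $d$-th syzygy of $\mathrm H^iM$ belongs to $\mathcal F$. Then $M\in\langle\mathcal F\rangle_{\max\{2,d+1\}}$. 2. The dimension of $\mathsf D^{\mathrm b}(\mathcal A)$ with respect to $\operatorname{res}(\Omega^d\mathcal A)$ is at most $\max\{1,d\}$. -/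

import Mathlib

open CategoryTheory CategoryTheory.Limits

universe w v u

namespace ResolvingDim

section Abelian

variable {A : Type u} [Category.{v} A] [Abelian A]

/-- `IsSyzygy d M X` means that `X` is a `d`-th syzygy of `M`: there is an exact sequence
`0 ⟶ X ⟶ P_{d-1} ⟶ ⋯ ⟶ P_0 ⟶ M ⟶ 0` with all `P_i` projective. It is presented through the
short exact sequences `0 ⟶ K ⟶ P_0 ⟶ M ⟶ 0`, … into which this sequence decomposes.
A `0`-th syzygy of `M` is an object isomorphic to `M`. -/
def IsSyzygy : ℕ → A → A → Prop
  | 0, M, X => Nonempty (X ≅ M)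
  | d + 1, M, X => ∃ S : ShortComplex A,
      S.ShortExact ∧ Projective S.X₂ ∧ Nonempty (S.X₃ ≅ M) ∧ IsSyzygy d S.X₁ X

/-- The full subcategory `Ω^d 𝒞` of all `d`-th syzygies of objects of a full subcategory `𝒞`. -/
def syzygies (d : ℕ) (P : ObjectProperty A) : ObjectProperty A :=
  fun X => ∃ M : A, P M ∧ IsSyzygy d M X

/-- Resolving subcategories: they contain the projectives, are closed under direct summands
(in an abelian category, the same as retracts), and for every short exact sequence
`0 ⟶ L ⟶ M ⟶ N ⟶ 0` with `N` in `F` one has `L` in `F` if and only if `M` is in `F`. -/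
structure IsResolving (F : ObjectProperty A) : Prop where
  projective_mem : ∀ P : A, Projective P → F P
  retracts : F.IsStableUnderRetracts
  mem_iff : ∀ S : ShortComplex A, S.ShortExact → F S.X₃ → (F S.X₁ ↔ F S.X₂)

/-- `res 𝒞`, the smallest resolving subcategory containing `𝒞`. -/
def res (P : ObjectProperty A) : ObjectProperty A :=
  fun X => ∀ F : ObjectProperty A, IsResolving F → P ≤ F → F X

lemma le_res (P : ObjectProperty A) : P ≤ res P :=
  fun X hX _ _ h => h X hX

lemma isResolving_res (P : ObjectProperty A) : IsResolving (res P) where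
  projective_mem Q hQ _ hF _ := hF.projective_mem Q hQ
  retracts := ⟨fun r hY F hF h => hF.retracts.of_retract r (hY F hF h)⟩
  mem_iff S hS h₃ :=
    ⟨fun h₁ F hF h => (hF.mem_iff S hS (h₃ F hF h)).1 (h₁ F hF h),
      fun h₂ F hF h => (hF.mem_iff S hS (h₃ F hF h)).2 (h₂ F hF h)⟩

end Abelian

section Triangulated

variable {T : Type u} [Category.{v} T]

/-- `add 𝒳`, the smallest full subcategory containing `𝒳` which is closed under finite direct
sums (including the empty one) and direct summands. (In the triangulated categories where this
is used, finite products are direct sums and retracts are direct summands.) -/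
def addClosure (P : ObjectProperty T) : ObjectProperty T :=
  fun X => ∀ Q : ObjectProperty T, P ≤ Q → Q.IsClosedUnderFiniteProducts →
    Q.IsStableUnderRetracts → Q X

lemma le_addClosure (P : ObjectProperty T) : P ≤ addClosure P :=
  fun X hX _ h _ _ => h X hX

lemma addClosure_isStableUnderRetracts (P : ObjectProperty T) :
    (addClosure P).IsStableUnderRetracts :=
  ⟨fun r hY Q h₁ h₂ h₃ => h₃.of_retract r (hY Q h₁ h₂ h₃)⟩

lemma addClosure_isClosedUnderFiniteProducts (P : ObjectProperty T) :
    (addClosure P).IsClosedUnderFiniteProducts where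
  isClosedUnderLimitsOfShape J _ := by
    refine ⟨?_⟩
    rintro X ⟨p⟩ Q h₁ h₂ h₃
    exact Q.prop_of_isLimit p.isLimit (fun j => p.prop_diag_obj j Q h₁ h₂ h₃)

variable [HasZeroObject T] [HasShift T ℤ] [Preadditive T]
  [∀ n : ℤ, (shiftFunctor T n).Additive] [Pretriangulated T]

/-- `⟨𝒳⟩_n = add (⟨𝒳⟩ * ⋯ * ⟨𝒳⟩)` with `n ≥ 1` factors, where `⟨𝒳⟩ = add {X[i] | X ∈ 𝒳, i ∈ ℤ}`
and `𝒳 * 𝒴` consists of the `M` in a distinguished triangle `X ⟶ M ⟶ Y ⟶ X[1]` with `X ∈ 𝒳` and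
`Y ∈ 𝒴`. (`extensionProductIter n` is the product of `n + 1` factors. For `n = 0` we take the
empty product, the zero objects.) -/
def level (P : ObjectProperty T) : ℕ → ObjectProperty T
  | 0 => IsZero
  | n + 1 => addClosure ((addClosure (P.shiftClosure ℤ)).extensionProductIter n)

/-- The dimension of `T` with respect to `𝒳`: the infimum of the `n ≥ 0` with `T = ⟨𝒳⟩_{n+1}`,
which is `∞` if there is no such `n`. -/
noncomputable def relDim (P : ObjectProperty T) : ℕ∞ :=
  ⨅ (n : ℕ) (_ : ∀ M : T, level P (n + 1) M), (n : ℕ∞)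

end Triangulated

section Derived

variable (A : Type u) [Category.{v} A] [Abelian A] [HasDerivedCategory.{w} A]

/-- The embedding of `A` in `D^b(A)`, as complexes concentrated in degree `0`. -/
noncomputable def single : A ⥤ DerivedCategory.Bounded A :=
  (DerivedCategory.TStructure.t (C := A)).bounded.lift (DerivedCategory.singleFunctor A 0)
    (fun _ => ⟨⟨0, inferInstance⟩, ⟨0, inferInstance⟩⟩)

/-- The cohomology functor `H^i : D^b(A) ⥤ A`. -/
noncomputable def cohomology (i : ℤ) : DerivedCategory.Bounded A ⥤ A :=
  DerivedCategory.Bounded.ι ⋙ DerivedCategory.homologyFunctor A i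

end Derived

end ResolvingDim

/-! Write `B[-n]` for `B` placed in degree `n`. If `d ≥ 2`, a map to `M` from a finite sum of
shifted projectives that is epi on cohomology has a cone whose cohomology consists of first syzygies
of that of `M`. Each such cone costs one factor and lowers `d` by one
(`exists_projective_approximation`), so everything reduces to `d = 1`, where two factors must
suffice; `d = 0` is a special case of `d = 1`.

For `d = 1`, the cohomology of `M` is removed from the top down. Coning off projectives `Q[-n]`
would use one factor per degree; instead the pieces are regrouped into one fiber `Z` and one
quotient `W`, both in `add` of shifts of `F`. The induction (`exists_extension`) treats triangles `N
⟶ M ⟶ Y` with `Y = B[-n]`, `B ∈ F`, and also demands that `M ⟶ Y` factor through `W`. This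
factorization splits the extension arising at the next stage (`exists_extension_step`).

Part 2 is part 1 applied to `res (Ω^d A)`, which contains every `d`-th syzygy. -/

namespace ResolvingDim

/-! ### Resolving subcategories and objects with a syzygy in them -/

section Abelian

variable {A : Type u} [Category.{v} A] [Abelian A]

namespace IsResolving

variable {F : ObjectProperty A} (hF : IsResolving F)
include hF

lemma prop_of_iso {X Y : A} (e : X ≅ Y) (hX : F X) : F Y :=
  hF.retracts.of_retract ⟨e.inv, e.hom, e.inv_hom_id⟩ hX

lemma prop_X₂ {S : ShortComplex A} (hS : S.ShortExact) (h₁ : F S.X₁) (h₃ : F S.X₃) : F S.X₂ :=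
  (hF.mem_iff S hS h₃).1 h₁

lemma prop_X₁ {S : ShortComplex A} (hS : S.ShortExact) (h₂ : F S.X₂) (h₃ : F S.X₃) : F S.X₁ :=
  (hF.mem_iff S hS h₃).2 h₂

lemma prop_of_isZero {X : A} (hX : IsZero X) : F X :=
  hF.projective_mem X hX.projective

end IsResolving

lemma IsSyzygy.of_iso {d : ℕ} {M M' X : A} (h : IsSyzygy d M X) (e : M ≅ M') :
    IsSyzygy d M' X := by
  cases d with
  | zero =>
    obtain ⟨e'⟩ := h
    exact ⟨e' ≪≫ e⟩
  | succ d =>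
    obtain ⟨S, hS, hP, ⟨e'⟩, h⟩ := h
    exact ⟨S, hS, hP, ⟨e' ≪≫ e⟩, h⟩

/-- The object `M` has a `d`-th syzygy which belongs to `F`. -/
def HasSyzygyIn (F : ObjectProperty A) (d : ℕ) (M : A) : Prop :=
  ∃ X : A, IsSyzygy d M X ∧ F X

namespace HasSyzygyIn

variable {F : ObjectProperty A} {d : ℕ}

lemma of_iso {M M' : A} (h : HasSyzygyIn F d M) (e : M ≅ M') : HasSyzygyIn F d M' := by
  obtain ⟨X, hX, hFX⟩ := h
  exact ⟨X, hX.of_iso e, hFX⟩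

lemma succ_iff {M : A} : HasSyzygyIn F (d + 1) M ↔
    ∃ S : ShortComplex A, S.ShortExact ∧ Projective S.X₂ ∧ Nonempty (S.X₃ ≅ M) ∧
      HasSyzygyIn F d S.X₁ := by
  constructor
  · rintro ⟨X, ⟨S, hS, hP, e, h⟩, hX⟩
    exact ⟨S, hS, hP, e, X, h, hX⟩
  · rintro ⟨S, hS, hP, e, X, h, hX⟩
    exact ⟨X, ⟨S, hS, hP, e, h⟩, hX⟩

lemma exists_shortExact {M : A} (h : HasSyzygyIn F (d + 1) M) :
    ∃ (K Q : A) (f : K ⟶ Q) (g : Q ⟶ M) (w : f ≫ g = 0),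
      (ShortComplex.mk f g w).ShortExact ∧ Projective Q ∧ HasSyzygyIn F d K := by
  obtain ⟨S, hS, hP, ⟨e⟩, h⟩ := succ_iff.1 h
  refine ⟨S.X₁, S.X₂, S.f, S.g ≫ e.hom, by simp, ?_, hP, h⟩
  exact ShortComplex.shortExact_of_iso
    (ShortComplex.isoMk (S₁ := S) (Iso.refl _) (Iso.refl _) e) hS

lemma of_shortExact {S : ShortComplex A} (hS : S.ShortExact) (hP : Projective S.X₂)
    (h : HasSyzygyIn F d S.X₁) : HasSyzygyIn F (d + 1) S.X₃ :=
  succ_iff.2 ⟨S, hS, hP, ⟨Iso.refl _⟩, h⟩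

lemma zero_iff (hF : IsResolving F) {M : A} : HasSyzygyIn F 0 M ↔ F M := by
  constructor
  · rintro ⟨X, ⟨e⟩, hX⟩
    exact hF.prop_of_iso e hX
  · intro h
    exact ⟨M, ⟨Iso.refl _⟩, h⟩

lemma of_isZero (hF : IsResolving F) (d : ℕ) {M : A} (hM : IsZero M) : HasSyzygyIn F d M := by
  induction d generalizing M with
  | zero => exact (zero_iff hF).2 (hF.prop_of_isZero hM)
  | succ d hd =>
    exact of_shortExact (S := ShortComplex.mk (0 : M ⟶ M) (𝟙 M) (by simp))
      (ShortComplex.Splitting.shortExact ⟨0, 𝟙 M, hM.eq_of_src _ _, by simp, hM.eq_of_src _ _⟩)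
      hM.projective (hd hM)

lemma one_of_prop [EnoughProjectives A] (hF : IsResolving F) {M : A} (hM : F M) :
    HasSyzygyIn F 1 M := by
  have hS : (ShortComplex.mk (kernel.ι (Projective.π M)) (Projective.π M)
      (by simp)).ShortExact := { exact := ShortComplex.exact_kernel _ }
  exact of_shortExact hS (Projective.projective_over M)
    ((zero_iff hF).2 (hF.prop_X₁ hS (hF.projective_mem _
      (Projective.projective_over M)) hM))

/-- The horseshoe lemma. -/
lemma one_of_extension [EnoughProjectives A] (hF : IsResolving F) {S : ShortComplex A}
    (hS : S.ShortExact) (h₁ : HasSyzygyIn F 1 S.X₁) (h₃ : HasSyzygyIn F 1 S.X₃) :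
    HasSyzygyIn F 1 S.X₂ := by
  obtain ⟨K₁, Q₁, f₁, g₁, w₁, ex₁, hQ₁, hK₁⟩ := h₁.exists_shortExact
  obtain ⟨K₃, Q₃, f₃, g₃, w₃, ex₃, hQ₃, hK₃⟩ := h₃.exists_shortExact
  rw [zero_iff hF] at hK₁ hK₃
  have := hS.epi_g
  have := hS.mono_f
  have : Epi g₁ := ex₁.epi_g
  have : Epi g₃ := ex₃.epi_g
  let L₁ : ShortComplex A := ShortComplex.mk (biprod.inl : Q₁ ⟶ Q₁ ⊞ Q₃) biprod.snd (by simp)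
  let l : Q₃ ⟶ S.X₂ := Projective.factorThru g₃ S.g
  have hl : l ≫ S.g = g₃ := Projective.factorThru_comp _ _
  let φ : L₁ ⟶ S :=
    { τ₁ := g₁
      τ₂ := biprod.desc (g₁ ≫ S.f) l
      τ₃ := g₃
      comm₁₂ := by simp [L₁]
      comm₂₃ := by dsimp [L₁]; ext <;> simp [hl] }
  have hL₁ : L₁.ShortExact := ShortComplex.Splitting.shortExact
    ⟨biprod.fst, biprod.inr, by simp [L₁], by simp [L₁], by simp [L₁]⟩
  let I : ShortComplex.SnakeInput A :=
    { L₀ := kernel φ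
      L₁ := L₁
      L₂ := S
      L₃ := cokernel φ
      v₀₁ := kernel.ι φ
      v₁₂ := φ
      v₂₃ := cokernel.π φ
      h₀ := kernelIsKernel φ
      h₃ := cokernelIsCokernel φ
      L₁_exact := hL₁.exact
      epi_L₁_g := hL₁.epi_g
      L₂_exact := hS.exact
      mono_L₂_f := hS.mono_f }
  have : Epi I.v₁₂.τ₁ := inferInstanceAs (Epi g₁)
  have : Epi I.v₁₂.τ₃ := inferInstanceAs (Epi g₃)
  have : Mono I.L₁.f := hL₁.mono_f
  have hφ₂ : Epi φ.τ₂ := ShortComplex.epi_τ₂_of_exact_of_epi φ hS.exact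
  -- The snake sequence continues the row of kernels by the cokernel of `g₁`; its vanishing makes
  -- that row short exact.
  have h0 : IsZero I.L₃.X₁ := by
    have h : I.v₂₃.τ₁ = 0 := by rw [← cancel_epi I.v₁₂.τ₁, I.w₁₃_τ₁, comp_zero]
    have := I.epi_v₂₃_τ₁
    exact IsZero.of_epi_eq_zero _ h
  have hL₀ : I.L₀.ShortExact :=
    { exact := I.L₀_exact
      mono_f := I.mono_L₀_f
      epi_g := I.L₁'_exact.epi_f (h0.eq_of_tgt _ _) }
  have e₁ : K₁ ≅ I.L₀.X₁ := IsLimit.conePointUniqueUpToIso ex₁.fIsKernel I.h₀τ₁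
  have e₃ : K₃ ≅ I.L₀.X₃ := IsLimit.conePointUniqueUpToIso ex₃.fIsKernel I.h₀τ₃
  have h₂ : F I.L₀.X₂ := hF.prop_X₂ hL₀ (hF.prop_of_iso e₁ hK₁) (hF.prop_of_iso e₃ hK₃)
  exact of_shortExact (S := ShortComplex.mk I.v₀₁.τ₂ I.v₁₂.τ₂ I.w₀₂_τ₂)
    { exact := I.exact_C₂_up
      mono_f := I.mono_v₀₁_τ₂
      epi_g := hφ₂ }
    (inferInstanceAs (Projective (Q₁ ⊞ Q₃))) ((zero_iff hF).2 h₂)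

/-- Resolve the last syzygy one step further: the kernel of a projective cover map onto an object of
`F` stays in `F`. -/
lemma succ [EnoughProjectives A] (hF : IsResolving F) {M : A} (h : HasSyzygyIn F d M) :
    HasSyzygyIn F (d + 1) M := by
  induction d generalizing M with
  | zero => exact one_of_prop hF ((zero_iff hF).1 h)
  | succ d hd =>
    obtain ⟨K, Q, f, g, w, ex, hQ, hK⟩ := h.exists_shortExact
    exact of_shortExact ex hQ (hd hK)

lemma exists_isSyzygy [EnoughProjectives A] (d : ℕ) (M : A) : ∃ X : A, IsSyzygy d M X := by
  induction d generalizing M with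
  | zero => exact ⟨M, ⟨Iso.refl _⟩⟩
  | succ d hd =>
    obtain ⟨X, hX⟩ := hd (kernel (Projective.π M))
    exact ⟨X, ShortComplex.mk (kernel.ι (Projective.π M)) (Projective.π M) (by simp),
      { exact := ShortComplex.exact_kernel _ },
      Projective.projective_over M, ⟨Iso.refl _⟩, hX⟩

end HasSyzygyIn

end Abelian
-- Morphisms out of shifted projectives and the long exact cohomology sequence
section Derived
open Pretriangulated Triangulated DerivedCategory

variable {A : Type u} [Category.{v} A] [Abelian A] [HasDerivedCategory.{w} A]

/-- A shifted projective is K-projective, so the morphism comes from a chain map into a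
representative of `X` vanishing above degree `m`. Source and target then share no nonzero degree. -/
lemma eq_zero_of_projective {Q : A} [Projective Q] {X : DerivedCategory A} (n m : ℤ) (h : m < n)
    [X.IsLE m] (f : (singleFunctor A n).obj Q ⟶ X) : f = 0 := by
  obtain ⟨K, _, ⟨e⟩⟩ := X.exists_iso_Q_obj_of_isLE m
  have hK : ((CochainComplex.singleFunctor A n).obj Q).IsKProjective := by
    have (i : ℤ) : Projective (((CochainComplex.singleFunctor A n).obj Q).X i) := by
      by_cases hi : i = n
      · subst hi
        exact Projective.of_iso (HomologicalComplex.singleObjXSelf (ComplexShape.up ℤ) i Q).symm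
          inferInstance
      · exact (HomologicalComplex.isZero_single_obj_X (ComplexShape.up ℤ) n Q i hi).projective
    exact CochainComplex.isKProjective_of_projective _ n
  obtain ⟨g, hg⟩ := (CochainComplex.IsKProjective.Qh_map_bijective
    ((CochainComplex.singleFunctor A n).obj Q)
    ((HomotopyCategory.quotient A (.up ℤ)).obj K)).2 (f ≫ e.hom)
  obtain ⟨g, rfl⟩ := (HomotopyCategory.quotient A (.up ℤ)).map_surjective g
  have hg0 : g = 0 := by
    ext i
    by_cases hi : i = n
    · exact (K.isZero_of_isStrictlyLE m i (by lia)).eq_of_tgt _ _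
    · exact (HomologicalComplex.isZero_single_obj_X (ComplexShape.up ℤ) n Q i hi).eq_of_src _ _
  rw [hg0, Functor.map_zero, Functor.map_zero] at hg
  exact (Preadditive.IsIso.comp_right_eq_zero f e.hom).1 hg.symm

section Homology

variable {X Y Z : DerivedCategory A} {f : X ⟶ Y} {g : Y ⟶ Z} {δ : Z ⟶ X⟦(1 : ℤ)⟧}
  (hT : Triangle.mk f g δ ∈ distTriang (DerivedCategory A))
include hT

lemma epi_homologyMap_mor₁ (n : ℤ) (h : IsZero ((homologyFunctor A n).obj Z)) :
    Epi ((homologyFunctor A n).map f) :=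
  (HomologySequence.epi_homologyMap_mor₁_iff _ hT n).2 (h.eq_of_tgt _ _)

lemma mono_homologyMap_mor₁ (n m : ℤ) (hnm : n + 1 = m)
    (h : IsZero ((homologyFunctor A n).obj Z)) :
    Mono ((homologyFunctor A m).map f) :=
  (HomologySequence.mono_homologyMap_mor₁_iff _ hT n m hnm).2 (h.eq_of_src _ _)

lemma epi_homologyMap_mor₂ (n m : ℤ) (hnm : n + 1 = m)
    (h : IsZero ((homologyFunctor A m).obj X)) :
    Epi ((homologyFunctor A n).map g) :=
  (HomologySequence.epi_homologyMap_mor₂_iff _ hT n m hnm).2 (h.eq_of_tgt _ _)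

lemma mono_homologyMap_mor₂ (n : ℤ) (h : IsZero ((homologyFunctor A n).obj X)) :
    Mono ((homologyFunctor A n).map g) :=
  (HomologySequence.mono_homologyMap_mor₂_iff _ hT n).2 (h.eq_of_src _ _)

lemma isIso_homologyMap_mor₁ (n m : ℤ) (hnm : n + 1 = m)
    (h : IsZero ((homologyFunctor A n).obj Z))
    (h' : IsZero ((homologyFunctor A m).obj Z)) :
    IsIso ((homologyFunctor A m).map f) := by
  have := epi_homologyMap_mor₁ hT m h'
  have := mono_homologyMap_mor₁ hT n m hnm h
  exact isIso_of_mono_of_epi _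

lemma isIso_homologyMap_mor₂ (n m : ℤ) (hnm : n + 1 = m)
    (h : IsZero ((homologyFunctor A n).obj X))
    (h' : IsZero ((homologyFunctor A m).obj X)) :
    IsIso ((homologyFunctor A n).map g) := by
  have := epi_homologyMap_mor₂ hT n m hnm h'
  have := mono_homologyMap_mor₂ hT n h
  exact isIso_of_mono_of_epi _

lemma isZero_homology_obj₁ (n m : ℤ) (hnm : n + 1 = m)
    (h₃ : Epi ((homologyFunctor A n).map g))
    (h₂ : IsZero ((homologyFunctor A m).obj Y)) :
    IsZero ((homologyFunctor A m).obj X) := by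
  have : Mono ((homologyFunctor A m).map f) :=
    (HomologySequence.mono_homologyMap_mor₁_iff _ hT n m hnm).2
    ((HomologySequence.epi_homologyMap_mor₂_iff _ hT n m hnm).1 h₃)
  exact IsZero.of_mono ((homologyFunctor A m).map f) h₂

lemma exists_lift_mor₁ {W : DerivedCategory A} (u : W ⟶ Y) (hu : u ≫ g = 0) :
    ∃ v : W ⟶ X, v ≫ f = u := by
  obtain ⟨v, hv⟩ := Triangle.coyoneda_exact₂ _ hT u hu
  exact ⟨v, hv.symm⟩

lemma exists_lift_mor₂ {W : DerivedCategory A} (u : W ⟶ Z) (hu : u ≫ δ = 0) :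
    ∃ v : W ⟶ Y, v ≫ g = u := by
  obtain ⟨v, hv⟩ := Triangle.coyoneda_exact₃ _ hT u hu
  exact ⟨v, hv.symm⟩

lemma mor_comp_mor : f ≫ g = 0 := comp_distTriang_mor_zero₁₂ _ hT

end Homology

lemma isZero_homology_single (B : A) (n i : ℤ) (h : i ≠ n) :
    IsZero ((homologyFunctor A i).obj ((singleFunctor A n).obj B)) := by
  obtain h | h := h.lt_or_gt
  · exact isZero_of_isGE _ n i h
  · exact isZero_of_isLE _ n i h

/-- A morphism from a projective object to the cohomology of an object `M` of the derived category
comes from a morphism to `M`. -/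
lemma exists_lift_of_projective {Q : A} [Projective Q] (M : DerivedCategory A) (n : ℤ)
    (f : Q ⟶ (homologyFunctor A n).obj M) :
    ∃ φ : (singleFunctor A n).obj Q ⟶ M, (homologyFunctor A n).map φ =
      (singleFunctorCompHomologyFunctorIso A n).hom.app Q ≫ f := by
  obtain ⟨L, R, hL, hR, a, b, c, hT⟩ := TStructure.t.exists_triangle M n (n + 1) rfl
  have : L.IsLE n := ⟨hL⟩
  have : R.IsGE (n + 1) := ⟨hR⟩
  have ha : IsIso ((homologyFunctor A n).map a) := isIso_homologyMap_mor₁ hT (n - 1) n (by lia)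
    (isZero_of_isGE _ (n + 1) _ (by lia)) (isZero_of_isGE _ (n + 1) _ (by lia))
  obtain ⟨L', R', hL', hR', a', b', c', hT'⟩ :=
    TStructure.t.exists_triangle L (n - 1) n (by lia)
  have : L'.IsLE (n - 1) := ⟨hL'⟩
  have : R'.IsGE n := ⟨hR'⟩
  have : L'⟦(1 : ℤ)⟧.IsLE (n - 2) := TStructure.t.isLE_shift L' (n - 1) 1 (n - 2)
  have hb' : IsIso ((homologyFunctor A n).map b') := isIso_homologyMap_mor₂ hT' n (n + 1) rfl
    (isZero_of_isLE _ (n - 1) _ (by lia)) (isZero_of_isLE _ (n - 1) _ (by lia))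
  have : R'.IsLE n := by
    rw [isLE_iff]
    intro i hi
    have := epi_homologyMap_mor₂ hT' i (i + 1) rfl (isZero_of_isLE _ (n - 1) _ (by lia))
    exact IsZero.of_epi ((homologyFunctor A i).map b') (isZero_of_isLE L n i hi)
  obtain ⟨C, ⟨e⟩⟩ := exists_iso_singleFunctor_obj_of_isGE_of_isLE R' n
  let u : Q ⟶ C := f ≫ inv ((homologyFunctor A n).map a) ≫ (homologyFunctor A n).map (b' ≫ e.hom) ≫
    (singleFunctorCompHomologyFunctorIso A n).hom.app C
  -- Here `R'` is the cohomology of `M` in degree `n`; the obstruction to lifting along `L ⟶ R'`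
  -- lies in `Hom(Q[-n], L'[1])`, which is zero.
  obtain ⟨ψ, hψ⟩ := exists_lift_mor₂ hT' ((singleFunctor A n).map u ≫ e.inv)
    (eq_zero_of_projective n (n - 2) (by lia) _)
  refine ⟨ψ ≫ a, ?_⟩
  have nat := (singleFunctorCompHomologyFunctorIso A n).hom.naturality u
  dsimp at nat
  have h1 : (homologyFunctor A n).map ψ ≫ (homologyFunctor A n).map b' ≫
      (homologyFunctor A n).map e.hom = (homologyFunctor A n).map ((singleFunctor A n).map u) := by
    rw [← Functor.map_comp, ← Functor.map_comp, ← Category.assoc, hψ]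
    simp
  rw [Functor.map_comp, ← cancel_mono (inv ((homologyFunctor A n).map a)),
    ← cancel_mono ((homologyFunctor A n).map b'), ← cancel_mono ((homologyFunctor A n).map e.hom),
    ← cancel_mono ((singleFunctorCompHomologyFunctorIso A n).hom.app C)]
  simp only [Category.assoc, IsIso.hom_inv_id_assoc]
  rw [reassoc_of% h1, nat]
  simp [u]

/-- A short exact sequence in `A` induces a distinguished triangle between complexes concentrated
in degree `n`. -/
lemma exists_distinguished_single {S : ShortComplex A} (hS : S.ShortExact) (n : ℤ) :
    ∃ δ, Triangle.mk ((singleFunctor A n).map S.f) ((singleFunctor A n).map S.g) δ ∈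
      distTriang (DerivedCategory A) :=
  ⟨_, triangleOfSES_distinguished
    (hS.map_of_exact (HomologicalComplex.single A (ComplexShape.up ℤ) n))⟩

end Derived
-- First syzygies in `F`: two factors suffice
section Derived
open Pretriangulated Triangulated DerivedCategory ZeroObject

variable {A : Type u} [Category.{v} A] [Abelian A] [HasDerivedCategory.{w} A]

lemma distinguished_of_iso₃ {X Y Z Z' : DerivedCategory A} {f : X ⟶ Y} {g : Y ⟶ Z}
    {δ : Z ⟶ X⟦(1 : ℤ)⟧} (hT : Triangle.mk f g δ ∈ distTriang (DerivedCategory A)) (e : Z' ≅ Z) :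
    Triangle.mk f (g ≫ e.inv) (e.hom ≫ δ) ∈ distTriang (DerivedCategory A) := by
  refine isomorphic_distinguished _ hT _
    (Triangle.isoMk _ _ (Iso.refl X) (Iso.refl Y) e
      ((Category.comp_id f).trans (Category.id_comp f).symm)
      (((Category.assoc _ _ _).trans ((congrArg (g ≫ ·) e.inv_hom_id).trans
        (Category.comp_id g))).trans (Category.id_comp g).symm) ?_)
  change (e.hom ≫ δ) ≫ (shiftFunctor (DerivedCategory A) (1 : ℤ)).map (𝟙 X) = e.hom ≫ δ
  rw [CategoryTheory.Functor.map_id, Category.comp_id]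

/-- The object `Y` of the derived category is isomorphic to an object of `F`, placed in
degree `n`. -/
def IsSingleIn (F : ObjectProperty A) (n : ℤ) (Y : DerivedCategory A) : Prop :=
  ∃ B : A, F B ∧ Nonempty (Y ≅ (singleFunctor A n).obj B)

lemma epi_homologyMap_single_iff {X Y : A} (f : X ⟶ Y) (n : ℤ) :
    Epi ((homologyFunctor A n).map ((singleFunctor A n).map f)) ↔ Epi f :=
  (MorphismProperty.epimorphisms A).arrow_mk_iso_iff
    (Arrow.isoMk ((singleFunctorCompHomologyFunctorIso A n).app X)
      ((singleFunctorCompHomologyFunctorIso A n).app Y)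
      ((singleFunctorCompHomologyFunctorIso A n).hom.naturality f).symm)

/-- Removes degree `n` from `N`. With `N₀ = τ_{<n} N`, the cone of `N₀ ⟶ M` is an extension of `Y`
by the top cohomology of `N`, hence some `C[-n]`, and `C` has a first syzygy `K ∈ F` by the
horseshoe lemma. The cover `Q ⟶ C` lifts to `Q[-n] ⟶ M`, and the octahedral axiom presents its cone
`M'` as an extension of `K[-n+1]` by `N₀`: the same situation one degree lower. -/
lemma exists_step [EnoughProjectives A] {F : ObjectProperty A} (hF : IsResolving F) {n a : ℤ}
    {N M Y : DerivedCategory A} {i : N ⟶ M} {g : M ⟶ Y} {δ : Y ⟶ N⟦(1 : ℤ)⟧}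
    (hT : Triangle.mk i g δ ∈ distTriang (DerivedCategory A))
    [N.IsLE n] [N.IsGE a] (hN : ∀ j, HasSyzygyIn F 1 ((homologyFunctor A j).obj N))
    (hY : IsSingleIn F n Y) :
    ∃ (Q : A) (N' M' Y' : DerivedCategory A) (φ : (singleFunctor A n).obj Q ⟶ M) (α : M ⟶ M')
      (β : M' ⟶ ((singleFunctor A n).obj Q)⟦(1 : ℤ)⟧)
      (i' : N' ⟶ M') (c : M' ⟶ Y') (δ' : Y' ⟶ N'⟦(1 : ℤ)⟧)
      (γ : Y' ⟶ ((singleFunctor A n).obj Q)⟦(1 : ℤ)⟧),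
      Projective Q ∧ Triangle.mk φ α β ∈ distTriang (DerivedCategory A) ∧
      Triangle.mk i' c δ' ∈ distTriang (DerivedCategory A) ∧
      N'.IsLE (n - 1) ∧ N'.IsGE a ∧ (∀ j, HasSyzygyIn F 1 ((homologyFunctor A j).obj N')) ∧
      IsSingleIn F (n - 1) Y' ∧ c ≫ γ = β ∧ Epi ((homologyFunctor A n).map (φ ≫ g)) := by
  obtain ⟨B, hB, ⟨eB⟩⟩ := hY
  have : Y.IsLE n := TStructure.t.isLE_of_iso eB.symm n
  have : Y.IsGE n := TStructure.t.isGE_of_iso eB.symm n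
  let N₀ := (TStructure.t.truncLT n).obj N
  let E := (TStructure.t.truncGE n).obj N
  let a₀ : N₀ ⟶ N := (TStructure.t.truncLTι n).app N
  let b₀ : N ⟶ E := (TStructure.t.truncGEπ n).app N
  let c₀ : E ⟶ N₀⟦(1 : ℤ)⟧ := (TStructure.t.truncGEδLT n).app N
  have hT₀ : Triangle.mk a₀ b₀ c₀ ∈ distTriang (DerivedCategory A) :=
    TStructure.t.triangleLTGE_distinguished n N
  have : N₀.IsLE (n - 1) := inferInstanceAs (TStructure.t.IsLE ((TStructure.t.truncLT n).obj N) _)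
  have : N₀.IsGE a := inferInstanceAs (TStructure.t.IsGE ((TStructure.t.truncLT n).obj N) _)
  have : E.IsLE n := inferInstanceAs (TStructure.t.IsLE ((TStructure.t.truncGE n).obj N) _)
  have : E.IsGE n := inferInstanceAs (TStructure.t.IsGE ((TStructure.t.truncGE n).obj N) _)
  have hN₀ (j : ℤ) : HasSyzygyIn F 1 ((homologyFunctor A j).obj N₀) := by
    by_cases hj : j < n
    · have : IsIso ((homologyFunctor A j).map a₀) :=
        isIso_homologyMap_mor₁ hT₀ (j - 1) j (by lia) (isZero_of_isGE _ n _ (by lia))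
          (isZero_of_isGE _ n _ (by lia))
      exact (hN j).of_iso (asIso ((homologyFunctor A j).map a₀)).symm
    · exact HasSyzygyIn.of_isZero hF 1 (isZero_of_isLE _ (n - 1) _ (by lia))
  have hE : HasSyzygyIn F 1 ((homologyFunctor A n).obj E) := by
    have : IsIso ((homologyFunctor A n).map b₀) :=
      isIso_homologyMap_mor₂ hT₀ n (n + 1) rfl (isZero_of_isLE _ (n - 1) _ (by lia))
        (isZero_of_isLE _ (n - 1) _ (by lia))
    exact (hN n).of_iso (asIso ((homologyFunctor A n).map b₀))
  obtain ⟨X, x, ξ, hX⟩ := distinguished_cocone_triangle (a₀ ≫ i)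
  have O := someOctahedron rfl hT₀ hT hX
  have hO : Triangle.mk O.m₁ O.m₃ (δ ≫ b₀⟦1⟧') ∈ distTriang (DerivedCategory A) := O.mem
  have : X.IsLE n := TStructure.t.isLE₂ _ hO n ‹E.IsLE n› ‹Y.IsLE n›
  have : X.IsGE n := TStructure.t.isGE₂ _ hO n ‹E.IsGE n› ‹Y.IsGE n›
  obtain ⟨C, ⟨e⟩⟩ := exists_iso_singleFunctor_obj_of_isGE_of_isLE X n
  have hm₃ : Epi ((homologyFunctor A n).map O.m₃) :=
    epi_homologyMap_mor₂ hO n (n + 1) rfl (isZero_of_isLE _ n _ (by lia))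
  have hC : HasSyzygyIn F 1 C := by
    have hm₁ : Mono ((homologyFunctor A n).map O.m₁) :=
      mono_homologyMap_mor₁ hO (n - 1) n (by lia) (isZero_of_isGE _ n _ (by lia))
    have h : (ShortComplex.mk ((homologyFunctor A n).map O.m₁) ((homologyFunctor A n).map O.m₃)
        (by rw [← Functor.map_comp, mor_comp_mor hO, Functor.map_zero])).ShortExact :=
      { exact := HomologySequence.exact₂ _ hO n
        mono_f := hm₁
        epi_g := hm₃ }
    have hY' : HasSyzygyIn F 1 ((homologyFunctor A n).obj Y) :=
      (HasSyzygyIn.one_of_prop hF hB).of_iso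
        (((singleFunctorCompHomologyFunctorIso A n).app B).symm ≪≫
          (homologyFunctor A n).mapIso eB.symm)
    exact (HasSyzygyIn.one_of_extension hF h hE hY').of_iso
      ((homologyFunctor A n).mapIso e ≪≫ (singleFunctorCompHomologyFunctorIso A n).app C)
  obtain ⟨K, Q, f, q, w, ex, hQ, hK⟩ := hC.exists_shortExact
  rw [HasSyzygyIn.zero_iff hF] at hK
  have hq : Epi q := ex.epi_g
  obtain ⟨ε, hε⟩ := exists_distinguished_single ex n
  dsimp at hε
  have hε' : Triangle.mk ((singleFunctor A n).map f) ((singleFunctor A n).map q ≫ e.inv)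
      (e.hom ≫ ε) ∈ distTriang (DerivedCategory A) := distinguished_of_iso₃ hε e
  have hψ := rot_of_distTriang _ hε'
  have : (N₀⟦(1 : ℤ)⟧).IsLE (n - 2) := TStructure.t.isLE_shift N₀ (n - 1) 1 (n - 2)
  obtain ⟨φ, hφ⟩ := exists_lift_mor₂ hX ((singleFunctor A n).map q ≫ e.inv)
    (eq_zero_of_projective n (n - 2) (by lia) _)
  obtain ⟨M', α, β, hα⟩ := distinguished_cocone_triangle φ
  -- Gives a triangle `M' ⟶ K[-n][1] ⟶ N₀[1]`; rotating it back puts `N₀[1][-1]` rather than `N₀` on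
  -- the left, whence `eN`.
  have O' := someOctahedron hφ hα (rot_of_distTriang _ hX) hψ
  have hO' := inv_rot_of_distTriang _ O'.mem
  let eN : (N₀⟦(1 : ℤ)⟧)⟦(-1 : ℤ)⟧ ≅ N₀ :=
    (shiftEquiv (DerivedCategory A) (1 : ℤ)).unitIso.symm.app N₀
  refine ⟨Q, (N₀⟦(1 : ℤ)⟧)⟦(-1 : ℤ)⟧, M', ((singleFunctor A n).obj K)⟦(1 : ℤ)⟧, φ, α, β, _,
    O'.m₁, _, _, hQ, hα, hO', TStructure.t.isLE_of_iso eN.symm _,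
    TStructure.t.isGE_of_iso eN.symm _,
    fun j ↦ (hN₀ j).of_iso ((homologyFunctor A j).mapIso eN.symm),
    ⟨K, hK, ⟨((singleFunctors A).shiftIso 1 (n - 1) n (by lia)).app K⟩⟩, O'.comm₂, ?_⟩
  have hg : φ ≫ g = (singleFunctor A n).map q ≫ e.inv ≫ O.m₃ := by
    have h₁ : x ≫ O.m₃ = g := O.comm₃
    exact (congrArg (φ ≫ ·) h₁.symm).trans ((reassoc_of% hφ) O.m₃)
  have := (epi_homologyMap_single_iff q n).2 hq
  rw [hg, Functor.map_comp, Functor.map_comp]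
  infer_instance

/-- Pulls a decomposition of `M'` back to `M`. The fiber `X` of `M ⟶ W'` extends `Z'` by `Q[-n]`,
with class `f' ≫ β`; this is zero because `β` factors through `h'`. Taking `W = Y ⊞ W'` makes `M ⟶
Y` factor through `W` and replaces `X` by the fiber of `X ⟶ Y`. That map kills `Z'` for degree
reasons and is an epimorphism `Q ⟶ B` on the other summand, so the fiber is built from `Z'` and `ker
(Q ⟶ B) ∈ F`. -/
lemma exists_extension_step [EnoughProjectives A] {F : ObjectProperty A} (hF : IsResolving F)
    (G : ObjectProperty (DerivedCategory A)) [G.IsStableUnderRetracts]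
    [G.IsClosedUnderFiniteProducts]
    (hG : ∀ (B : A) (n : ℤ), F B → G ((singleFunctor A n).obj B)) {n : ℤ} {Q : A} [Projective Q]
    {M M' Y Y' Z' W' : DerivedCategory A} {φ : (singleFunctor A n).obj Q ⟶ M} {α : M ⟶ M'}
    {β : M' ⟶ ((singleFunctor A n).obj Q)⟦(1 : ℤ)⟧}
    (hα : Triangle.mk φ α β ∈ distTriang (DerivedCategory A))
    {c : M' ⟶ Y'} {γ : Y' ⟶ ((singleFunctor A n).obj Q)⟦(1 : ℤ)⟧} (hβ : c ≫ γ = β)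
    {f' : Z' ⟶ M'} {h' : M' ⟶ W'} {ε' : W' ⟶ Z'⟦(1 : ℤ)⟧}
    (hT' : Triangle.mk f' h' ε' ∈ distTriang (DerivedCategory A))
    (hZ' : G Z') [Z'.IsLE (n - 1)] (hW' : G W') {p' : W' ⟶ Y'} (hp' : h' ≫ p' = c)
    (hY : IsSingleIn F n Y) (g : M ⟶ Y) (hg : Epi ((homologyFunctor A n).map (φ ≫ g))) :
    ∃ (Z W : DerivedCategory A) (f : Z ⟶ M) (h : M ⟶ W) (ε : W ⟶ Z⟦(1 : ℤ)⟧) (p : W ⟶ Y),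
      Triangle.mk f h ε ∈ distTriang (DerivedCategory A) ∧ G Z ∧ Z.IsLE n ∧ G W ∧ h ≫ p = g := by
  obtain ⟨B, hB, ⟨eB⟩⟩ := hY
  have : Y.IsGE n := TStructure.t.isGE_of_iso eB.symm n
  have : Y.IsLE n := TStructure.t.isLE_of_iso eB.symm n
  have hGY : G Y := G.prop_of_iso eB.symm (hG B n hB)
  -- the fiber of `M ⟶ W'` is the direct sum of `Q` and `Z'`
  obtain ⟨X, v, w, hX⟩ := distinguished_cocone_triangle₁ (α ≫ h')
  have O := someOctahedron' rfl hα hT' hX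
  have hO : Triangle.mk O.m₁ O.m₃ (f' ≫ β) ∈ distTriang (DerivedCategory A) := O.mem
  have h₀ : f' ≫ β = 0 := by
    rw [← hβ, ← hp', Category.assoc, reassoc_of% (mor_comp_mor hT'), zero_comp]
  obtain ⟨s, hs⟩ := exists_lift_mor₂ hO (𝟙 Z') (by rw [h₀, comp_zero])
  obtain ⟨r, hr⟩ := exists_lift_mor₁ hO (𝟙 X - O.m₃ ≫ s)
    (by rw [Preadditive.sub_comp, Category.assoc, hs, Category.id_comp, Category.comp_id, sub_self])
  have : X.IsLE n := TStructure.t.isLE₂ _ hO n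
    (inferInstanceAs (IsLE ((singleFunctor A n).obj Q) n))
    (TStructure.t.isLE_of_le Z' (n - 1) n)
  -- the fiber of `M ⟶ Y ⊞ W'`
  let h : M ⟶ Y ⊞ W' := biprod.lift g (α ≫ h')
  obtain ⟨Z, f, ε, hT⟩ := distinguished_cocone_triangle₁ h
  have hY' : Triangle.mk (biprod.inl : Y ⟶ Y ⊞ W') biprod.snd 0 ∈
      distTriang (DerivedCategory A) := binaryBiproductTriangle_distinguished Y W'
  have O' := someOctahedron' (show h ≫ biprod.snd = α ≫ h' by simp [h]) hT hY' hX
  have hO' : Triangle.mk O'.m₁ O'.m₃ (biprod.inl ≫ ε) ∈ distTriang (DerivedCategory A) := O'.mem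
  have hm : O'.m₃ = v ≫ g := by
    have h₄ : O'.m₃ ≫ biprod.inl = v ≫ h := O'.comm₄
    have := congrArg (· ≫ biprod.fst) h₄
    simpa [h] using this
  have hmφ : O.m₁ ≫ O'.m₃ = φ ≫ g := by
    have h₁ : O.m₁ ≫ v = φ := O.comm₁
    rw [hm, reassoc_of% h₁]
  have hms : s ≫ O'.m₃ = 0 := TStructure.t.zero _ (n - 1) n
  have hmr : O'.m₃ = r ≫ φ ≫ g := by
    have := congrArg (· ≫ O'.m₃) hr
    simp only [Preadditive.sub_comp, Category.assoc, hms, comp_zero, sub_zero,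
      Category.id_comp, hmφ] at this
    exact this.symm
  have : Z.IsLE n := by
    rw [isLE_iff]
    intro i hi
    refine isZero_homology_obj₁ hO' (i - 1) i (by lia) ?_ (isZero_of_isLE X n i hi)
    by_cases hin : i - 1 = n
    · subst hin
      rw [← hmφ, Functor.map_comp] at hg
      exact epi_of_epi ((homologyFunctor A (i - 1)).map O.m₁) _
    · have : IsZero ((homologyFunctor A (i - 1)).obj Y) := isZero_of_isLE Y n _ (by lia)
      exact ⟨fun _ _ _ ↦ this.eq_of_src _ _⟩
  -- the kernel of `Q ⟶ B`
  let q : Q ⟶ B := (singleFunctor A n).preimage (φ ≫ g ≫ eB.hom)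
  have hq : (singleFunctor A n).map q = φ ≫ g ≫ eB.hom := Functor.map_preimage _ _
  have : Epi q := by
    rw [← epi_homologyMap_single_iff q n, hq, ← Category.assoc, Functor.map_comp]
    infer_instance
  have ex : (ShortComplex.mk (kernel.ι q) q (by simp)).ShortExact :=
    { exact := ShortComplex.exact_kernel _ }
  obtain ⟨η, hη⟩ := exists_distinguished_single ex n
  have hK : F (kernel q) := hF.prop_X₁ ex (hF.projective_mem _ ‹_›) hB
  obtain ⟨r₁, hr₁⟩ := exists_lift_mor₁ hη (O'.m₁ ≫ r) (by
    have h₁ : O'.m₁ ≫ r ≫ φ ≫ g = 0 := by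
      rw [← hmr]
      exact mor_comp_mor hO'
    have h₂ := congrArg (· ≫ eB.hom) h₁
    simpa [hq] using h₂)
  obtain ⟨j₁, hj₁⟩ := exists_lift_mor₁ hO' ((singleFunctor A n).map (kernel.ι q) ≫ O.m₁) (by
    rw [Category.assoc, hmφ, ← cancel_mono eB.hom, Category.assoc, Category.assoc, ← hq,
      ← Functor.map_comp, kernel.condition, Functor.map_zero, zero_comp])
  obtain ⟨s', hs'⟩ := exists_lift_mor₁ hO' s hms
  -- The two sides agree after composing with `Z ⟶ X`, so their difference factors through `Y[-1]`;
  -- since `Z` lies in degrees `≤ n` and `Y[-1]` in degrees `≥ n + 1`, it is zero.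
  have hid : r₁ ≫ j₁ + (O'.m₁ ≫ O.m₃) ≫ s' = 𝟙 Z := by
    obtain ⟨t, ht⟩ := Triangle.coyoneda_exact₂ _ (inv_rot_of_distTriang _ hO')
      (r₁ ≫ j₁ + (O'.m₁ ≫ O.m₃) ≫ s' - 𝟙 Z) (by
        change _ ≫ O'.m₁ = 0
        dsimp at hr₁
        simp only [Preadditive.sub_comp, Preadditive.add_comp, Category.assoc, hj₁, hs',
          reassoc_of% hr₁, hr, Preadditive.comp_sub, Category.comp_id, Category.id_comp]
        abel)
    have : (Y⟦(-1 : ℤ)⟧).IsGE (n + 1) := TStructure.t.isGE_shift Y n (-1) (n + 1)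
    have ht₀ : t = 0 := TStructure.t.zero_of_isLE_of_isGE t n (n + 1) (by lia) ‹_› this
    rw [ht₀, zero_comp] at ht
    exact sub_eq_zero.1 ht
  have hZ : G Z := G.prop_of_retract (Y := (singleFunctor A n).obj (kernel q) ⊞ Z')
    { i := biprod.lift r₁ (O'.m₁ ≫ O.m₃)
      r := biprod.desc j₁ s'
      retract := by rw [biprod.lift_desc, hid] }
    (G.prop_of_isLimit_binaryFan (BinaryBiproduct.isLimit _ _) (hG _ n hK) hZ')
  exact ⟨Z, Y ⊞ W', f, h, ε, biprod.fst, hT, hZ, ‹_›,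
    G.prop_of_isLimit_binaryFan (BinaryBiproduct.isLimit _ _) hGY hW', by simp [h]⟩

/-- Induction on `k`, the number of degrees in which `N` may have cohomology. The bound `Z.IsLE n`
and the factorization through `p` are what the next stage of the induction consumes. -/
theorem exists_extension [EnoughProjectives A] {F : ObjectProperty A} (hF : IsResolving F)
    (G : ObjectProperty (DerivedCategory A)) [G.IsStableUnderRetracts]
    [G.IsClosedUnderFiniteProducts]
    (hG : ∀ (B : A) (n : ℤ), F B → G ((singleFunctor A n).obj B)) (k : ℕ) (n : ℤ)
    {N M Y : DerivedCategory A} {i : N ⟶ M} {g : M ⟶ Y} {δ : Y ⟶ N⟦(1 : ℤ)⟧}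
    (hT : Triangle.mk i g δ ∈ distTriang (DerivedCategory A))
    [N.IsLE n] [N.IsGE (n - k + 1)] (hN : ∀ j, HasSyzygyIn F 1 ((homologyFunctor A j).obj N))
    (hY : IsSingleIn F n Y) :
    ∃ (Z W : DerivedCategory A) (f : Z ⟶ M) (h : M ⟶ W) (ε : W ⟶ Z⟦(1 : ℤ)⟧) (p : W ⟶ Y),
      Triangle.mk f h ε ∈ distTriang (DerivedCategory A) ∧ G Z ∧ Z.IsLE n ∧ G W ∧ h ≫ p = g := by
  induction k generalizing n N M Y with
  | zero =>
    have hN₀ : IsZero N := by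
      have : N.IsGE (n + 1) := by
        simpa using (inferInstance : N.IsGE (n - (0 : ℕ) + 1))
      exact TStructure.t.isZero N n (n + 1)
    obtain ⟨B, hB, ⟨e⟩⟩ := hY
    have hZ := G.prop_of_isTerminal N hN₀.isTerminal
    exact ⟨N, Y, i, g, δ, 𝟙 Y, hT, hZ, inferInstance, G.prop_of_iso e.symm (hG B n hB),
      Category.comp_id g⟩
  | succ k hk =>
    obtain ⟨Q, N', M', Y', φ, α, β, i', c, δ', γ, hQ, hα, hT', hN'₁, hN'₂, hN', hY', hγ, hφ⟩ :=
      exists_step (a := n - (k + 1 : ℕ) + 1) hF hT hN hY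
    have : N'.IsGE (n - 1 - k + 1) := TStructure.t.isGE_of_ge N' _ (n - (k + 1 : ℕ) + 1)
    obtain ⟨Z', W', f', h', ε', p', hT'', hZ', hZ'₁, hW', hp'⟩ := hk (n - 1) hT' hN' hY'
    exact exists_extension_step hF G hG hα hγ hT'' hZ' hW' hp' hY g hφ

/-- If the cohomology objects of a bounded object `M` of the derived category have a first syzygy
in `F`, then `M` is an extension of two objects of `G`, for every `G` which contains the shifts of
objects of `F` and is closed under finite direct sums and direct summands. -/
theorem extensionProduct_of_hasSyzygyIn_one [EnoughProjectives A] {F : ObjectProperty A}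
    (hF : IsResolving F) (G : ObjectProperty (DerivedCategory A)) [G.IsStableUnderRetracts]
    [G.IsClosedUnderFiniteProducts]
    (hG : ∀ (B : A) (n : ℤ), F B → G ((singleFunctor A n).obj B)) (M : DerivedCategory A) (a b : ℤ)
    [M.IsGE a] [M.IsLE b] (hM : ∀ j, HasSyzygyIn F 1 ((homologyFunctor A j).obj M)) :
    G.extensionProduct G M := by
  have hY : IsSingleIn F b (0 : DerivedCategory A) :=
    ⟨0, hF.prop_of_isZero (isZero_zero A),
      ⟨(isZero_zero _).iso ((singleFunctor A b).map_isZero (isZero_zero A))⟩⟩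
  -- The induction starts from `Y = 0` and `N = M`, with one step for each degree from `a` to `b`.
  have : M.IsGE (b - (b - a + 1).toNat + 1) := TStructure.t.isGE_of_ge M _ a
  obtain ⟨Z, W, f, h, ε, p, hT, hZ, _, hW, _⟩ :=
    exists_extension hF G hG (b - a + 1).toNat b (contractible_distinguished M) hM hY
  exact ⟨Z, W, f, h, ε, hT, hZ, hW⟩

end Derived
-- Projective approximations and induction on `d`
section Derived
open Pretriangulated Triangulated DerivedCategory ZeroObject

variable {A : Type u} [Category.{v} A] [Abelian A] [HasDerivedCategory.{w} A]

section Biproduct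

variable {J : Type} [Fintype J] (n : J → ℤ) (Q : J → A)

lemma id_homology_biproduct_single (i : ℤ) :
    𝟙 ((homologyFunctor A i).obj (⨁ fun j ↦ (singleFunctor A (n j)).obj (Q j))) =
      ∑ j, (homologyFunctor A i).map (biproduct.π _ j) ≫
        (homologyFunctor A i).map (biproduct.ι (fun j ↦ (singleFunctor A (n j)).obj (Q j)) j) := by
  rw [← CategoryTheory.Functor.map_id, ← biproduct.total, Functor.map_sum]
  simp only [Functor.map_comp]

lemma isZero_homology_biproduct_single (i : ℤ) (hi : ∀ j, n j ≠ i) :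
    IsZero ((homologyFunctor A i).obj (⨁ fun j ↦ (singleFunctor A (n j)).obj (Q j))) := by
  rw [IsZero.iff_id_eq_zero, id_homology_biproduct_single]
  refine Finset.sum_eq_zero fun j _ ↦ ?_
  rw [(isZero_homology_single (Q j) (n j) i (hi j).symm).eq_of_src
    ((homologyFunctor A i).map (biproduct.ι (fun j ↦ (singleFunctor A (n j)).obj (Q j)) j)) 0,
    comp_zero]

lemma isIso_homologyMap_biproduct_ι_single (hn : Function.Injective n) (j : J) :
    IsIso ((homologyFunctor A (n j)).map
      (biproduct.ι (fun j ↦ (singleFunctor A (n j)).obj (Q j)) j)) := by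
  refine ⟨(homologyFunctor A (n j)).map (biproduct.π _ j), ?_, ?_⟩
  · rw [← Functor.map_comp, biproduct.ι_π_self, CategoryTheory.Functor.map_id]
  · rw [id_homology_biproduct_single, Finset.sum_eq_single j]
    · intro k _ hk
      rw [(isZero_homology_single (Q k) (n k) (n j) (hn.ne hk.symm)).eq_of_src
        ((homologyFunctor A (n j)).map
          (biproduct.ι (fun j ↦ (singleFunctor A (n j)).obj (Q j)) k)) 0,
        comp_zero]
    · simp

end Biproduct

variable {F : ObjectProperty A} (hF : IsResolving F)
  (G : ObjectProperty (DerivedCategory A)) [G.IsClosedUnderFiniteProducts]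
  (hG : ∀ (B : A) (n : ℤ), F B → G ((singleFunctor A n).obj B))

include hF hG

/-- Lift a projective cover map of each cohomology object to `M` and sum over the degrees in `[a,
b]`. The sum is epi on cohomology, so the long exact sequence identifies the cohomology of the cone
in degree `i` with the chosen syzygy in degree `i + 1`; hence the bound `a - 1`. -/
lemma exists_projective_approximation (d : ℕ) (M : DerivedCategory A) (a b : ℤ) [M.IsGE a]
    [M.IsLE b] (hM : ∀ j, HasSyzygyIn F (d + 1) ((homologyFunctor A j).obj M)) :
    ∃ (P M' : DerivedCategory A) (f : P ⟶ M) (g : M ⟶ M') (δ : M' ⟶ P⟦(1 : ℤ)⟧),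
      Triangle.mk f g δ ∈ distTriang (DerivedCategory A) ∧ G P ∧ M'.IsGE (a - 1) ∧ M'.IsLE b ∧
        ∀ j, HasSyzygyIn F d ((homologyFunctor A j).obj M') := by
  choose K Q k q w ex hQ hK using fun j ↦ (hM j).exists_shortExact
  choose φ hφ using fun j ↦ exists_lift_of_projective M j (q j)
  let J := Finset.Icc a b
  let n : J → ℤ := Subtype.val
  let S : J → DerivedCategory A := fun j ↦ (singleFunctor A (n j)).obj (Q (n j))
  let Φ : ⨁ S ⟶ M := biproduct.desc fun j ↦ φ (n j)
  have hJ (i : ℤ) (hi : i ∉ J) : IsZero ((homologyFunctor A i).obj (⨁ S)) :=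
    isZero_homology_biproduct_single n _ i fun j hj ↦ hi (hj ▸ j.2)
  have hι (j : J) : IsIso ((homologyFunctor A (n j)).map (biproduct.ι S j)) :=
    isIso_homologyMap_biproduct_ι_single n (fun j ↦ Q (n j)) Subtype.val_injective j
  have hΦ (j : J) : (homologyFunctor A (n j)).map (biproduct.ι S j) ≫
      (homologyFunctor A (n j)).map Φ =
        (singleFunctorCompHomologyFunctorIso A (n j)).hom.app _ ≫ q (n j) := by
    rw [← Functor.map_comp, biproduct.ι_desc, hφ]
  have hepi (i : ℤ) : Epi ((homologyFunctor A i).map Φ) := by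
    by_cases hi : i ∈ J
    · have : Epi (q i) := (ex i).epi_g
      have : Epi ((homologyFunctor A i).map (biproduct.ι S ⟨i, hi⟩) ≫
          (homologyFunctor A i).map Φ) := by
        rw [hΦ ⟨i, hi⟩]
        exact epi_comp _ (q i)
      exact epi_of_epi ((homologyFunctor A i).map (biproduct.ι S ⟨i, hi⟩)) _
    · have : IsZero ((homologyFunctor A i).obj M) := by
        rw [Finset.mem_Icc] at hi
        by_cases ha : a ≤ i
        · exact isZero_of_isLE M b i (by lia)
        · exact isZero_of_isGE M a i (by lia)
      exact ⟨fun _ _ _ ↦ this.eq_of_src _ _⟩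
  obtain ⟨M', g, δ, hT⟩ := distinguished_cocone_triangle Φ
  have hmono (i : ℤ) : Mono (HomologySequence.δ (Triangle.mk Φ g δ) i (i + 1) rfl) :=
    (HomologySequence.exact₃ _ hT i (i + 1) rfl).mono_g
      ((HomologySequence.epi_homologyMap_mor₁_iff _ hT i).1 (hepi i))
  have hzero (i : ℤ) (hi : i + 1 ∉ J) : IsZero ((homologyFunctor A i).obj M') :=
    @IsZero.of_mono _ _ _ _ _
      (HomologySequence.δ (Triangle.mk Φ g δ) i (i + 1) rfl) (hmono i) (hJ _ hi)
  refine ⟨⨁ S, M', Φ, g, δ, hT, ?_, ?_, ?_, fun i ↦ ?_⟩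
  · exact G.prop_of_isLimit_fan (biproduct.isLimit S)
      fun j ↦ hG _ _ (hF.projective_mem _ (hQ _))
  · rw [isGE_iff]
    exact fun i hi ↦ hzero i (by rw [Finset.mem_Icc]; lia)
  · rw [isLE_iff]
    exact fun i hi ↦ hzero i (by rw [Finset.mem_Icc]; lia)
  · by_cases hi : i + 1 ∈ J
    · let j : J := ⟨i + 1, hi⟩
      let e : Q (i + 1) ≅ (homologyFunctor A (i + 1)).obj (⨁ S) :=
        ((singleFunctorCompHomologyFunctorIso A (i + 1)).app (Q (i + 1))).symm ≪≫
          @asIso _ _ _ _ _ (hι j)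
      have he : e.hom ≫ (homologyFunctor A (i + 1)).map Φ = q (i + 1) := by
        have := hΦ j
        dsimp [e, j, n] at this ⊢
        rw [Category.assoc, this, Iso.inv_hom_id_app_assoc]
      have ex' : (ShortComplex.mk (k (i + 1) ≫ e.hom) ((homologyFunctor A (i + 1)).map Φ)
          (by rw [Category.assoc, he, w])).ShortExact :=
        ShortComplex.shortExact_of_iso (ShortComplex.isoMk
          (S₁ := ShortComplex.mk (k (i + 1)) (q (i + 1)) (w (i + 1)))
          (Iso.refl _) e (Iso.refl _) (by simp) (by simp [he])) (ex (i + 1))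
      have ex'' := HomologySequence.exact₁ _ hT i (i + 1) rfl
      have : Mono (ShortComplex.mk _ _ (HomologySequence.δ_comp _ hT i (i + 1) rfl)).f := hmono i
      exact (hK (i + 1)).of_iso
        (IsLimit.conePointUniqueUpToIso ex'.fIsKernel ex''.fIsKernel)
    · exact HasSyzygyIn.of_isZero hF d (hzero i hi)

theorem extensionProductIter_of_hasSyzygyIn [EnoughProjectives A] [G.IsStableUnderRetracts]
    (d : ℕ) (M : DerivedCategory A) (a b : ℤ) [M.IsGE a] [M.IsLE b]
    (hM : ∀ j, HasSyzygyIn F (d + 1) ((homologyFunctor A j).obj M)) :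
    G.extensionProductIter (d + 1) M := by
  induction d generalizing M a b with
  | zero => exact extensionProduct_of_hasSyzygyIn_one hF G hG M a b hM
  | succ d hd =>
    obtain ⟨P, M', f, g, δ, hT, hP, _, _, hM'⟩ :=
      exists_projective_approximation hF G hG (d + 1) M a b hM
    rw [ObjectProperty.extensionProductIter_succ]
    exact ⟨P, M', f, g, δ, hT, hP, hd M' (a - 1) b hM'⟩

end Derived
-- Passage from the derived category to its bounded part
section Transport

open Pretriangulated Triangulated DerivedCategory

section FullyFaithful

variable {C D : Type*} [Category* C] [Category* D] [Preadditive C] [Preadditive D]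
  [HasZeroObject C] [HasZeroObject D] [HasShift C ℤ] [HasShift D ℤ]
  [∀ n : ℤ, (shiftFunctor C n).Additive] [∀ n : ℤ, (shiftFunctor D n).Additive]
  [Pretriangulated C] [Pretriangulated D] (L : C ⥤ D) [L.CommShift ℤ] [L.IsTriangulated]
  [L.Full]

/-- By fullness the connecting morphism lifts to `C`; completing the lift to a triangle there gives
an object whose image is the given extension. -/
lemma extensionProduct_map_le (P R : ObjectProperty C) :
    (P.map L).extensionProduct (R.map L) ≤ (P.extensionProduct R).map L := by
  rintro X ⟨Y, Z, f, g, h, hT, hY, hZ⟩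
  rw [ObjectProperty.prop_map_iff] at hY hZ ⊢
  obtain ⟨Y₀, hY₀, ⟨eY⟩⟩ := hY
  obtain ⟨Z₀, hZ₀, ⟨eZ⟩⟩ := hZ
  obtain ⟨h₀, hh₀⟩ := L.map_surjective
    (eZ.hom ≫ h ≫ eY.inv⟦(1 : ℤ)⟧' ≫ (L.commShiftIso (1 : ℤ)).inv.app Y₀)
  obtain ⟨X₀, f₀, g₀, hT₀⟩ := distinguished_cocone_triangle₂ h₀
  refine ⟨X₀, ⟨Y₀, Z₀, f₀, g₀, h₀, hT₀, hY₀, hZ₀⟩, ⟨Triangle.π₂.mapIso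
    (isoTriangleOfIso₁₃ _ _ (L.map_distinguished _ hT₀) hT eY eZ ?_)⟩⟩
  change (L.map h₀ ≫ (L.commShiftIso (1 : ℤ)).hom.app Y₀) ≫ eY.hom⟦(1 : ℤ)⟧' = eZ.hom ≫ h
  rw [hh₀]
  simp [← Functor.map_comp]

lemma extensionProductIter_map_le (P : ObjectProperty C) (n : ℕ) :
    (P.map L).extensionProductIter n ≤ (P.extensionProductIter n).map L := by
  induction n with
  | zero => exact le_rfl
  | succ n hn =>
    rw [ObjectProperty.extensionProductIter_succ, ObjectProperty.extensionProductIter_succ]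
    exact (ObjectProperty.monotone_extensionProduct_right _ hn).trans
      (extensionProduct_map_le L _ _)

end FullyFaithful

lemma map_isClosedUnderFiniteProducts {C D : Type*} [Category* C] [Category* D]
    [HasFiniteProducts C] (L : C ⥤ D) [PreservesFiniteProducts L] (P : ObjectProperty C)
    [P.IsClosedUnderFiniteProducts] : (P.map L).IsClosedUnderFiniteProducts where
  isClosedUnderLimitsOfShape J _ := by
    refine ⟨?_⟩
    rintro X ⟨p⟩
    choose Y hY e using fun j ↦ (ObjectProperty.prop_map_iff P L _).1 (p.prop_diag_obj ⟨j⟩)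
    refine (ObjectProperty.prop_map_iff P L _).2 ⟨∏ᶜ Y, P.prop_product hY, ⟨?_⟩⟩
    exact IsLimit.conePointsIsoOfNatIso
      (isLimitOfPreserves L (limit.isLimit (Discrete.functor Y))) p.isLimit
      (Discrete.natIso fun j ↦ (e j.as).some)

variable {A : Type u} [Category.{v} A] [Abelian A] [HasDerivedCategory.{w} A]

lemma isGE_of_retract {X Y : DerivedCategory A} (r : Retract X Y) (n : ℤ) [Y.IsGE n] :
    X.IsGE n := by
  rw [isGE_iff]
  intro i hi
  exact IsZero.of_mono ((r.map (homologyFunctor A i)).i) (isZero_of_isGE Y n i hi)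

lemma isLE_of_retract {X Y : DerivedCategory A} (r : Retract X Y) (n : ℤ) [Y.IsLE n] :
    X.IsLE n := by
  rw [isLE_iff]
  intro i hi
  exact IsZero.of_mono ((r.map (homologyFunctor A i)).i) (isZero_of_isLE Y n i hi)

/-- A retract of a bounded object is bounded, and full faithfulness moves the retraction into the
bounded category. -/
lemma map_ι_isStableUnderRetracts (P : ObjectProperty (Bounded A)) [P.IsStableUnderRetracts] :
    (P.map Bounded.ι).IsStableUnderRetracts where
  of_retract {X Y} r hY := by
    rw [ObjectProperty.prop_map_iff] at hY ⊢
    obtain ⟨Y₀, hY₀, ⟨e⟩⟩ := hY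
    let r' : Retract X Y₀.obj := r.trans (Retract.ofIso e.symm)
    have hX : TStructure.t.bounded X := by
      obtain ⟨⟨a, _⟩, ⟨b, _⟩⟩ := Y₀.property
      exact ⟨⟨a, isGE_of_retract r' a⟩, ⟨b, isLE_of_retract r' b⟩⟩
    let X₀ : Bounded A := ⟨X, hX⟩
    have h : Retract X₀ Y₀ :=
      { i := Bounded.ι.preimage r'.i
        r := Bounded.ι.preimage r'.r
        retract := Bounded.ι.map_injective (by
          rw [Functor.map_comp, Functor.map_preimage, Functor.map_preimage,
            CategoryTheory.Functor.map_id]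
          exact r'.retract) }
    exact ⟨X₀, P.prop_of_retract h hY₀, ⟨Iso.refl _⟩⟩

lemma map_ι_single (F : ObjectProperty A) (B : A) (n : ℤ) (hB : F B) :
    ((addClosure ((F.map (single A)).shiftClosure ℤ)).map Bounded.ι)
      ((singleFunctor A n).obj B) := by
  rw [ObjectProperty.prop_map_iff]
  refine ⟨((single A).obj B)⟦-n⟧, le_addClosure _ _
    ⟨(single A).obj B, -n, Iso.refl _, ObjectProperty.prop_map_obj _ _ hB⟩, ⟨?_⟩⟩
  exact (Bounded.ι.commShiftIso (-n)).app ((single A).obj B) ≪≫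
    ((singleFunctors A).shiftIso (-n) n 0 (by lia)).app B

theorem level_of_hasSyzygyIn [EnoughProjectives A] {F : ObjectProperty A} (hF : IsResolving F)
    (d : ℕ) (M : Bounded A) (hM : ∀ i, HasSyzygyIn F (d + 1) ((cohomology A i).obj M)) :
    level (F.map (single A)) (d + 2) M := by
  let P := addClosure ((F.map (single A)).shiftClosure ℤ)
  have : P.IsStableUnderRetracts := addClosure_isStableUnderRetracts _
  have : P.IsClosedUnderFiniteProducts := addClosure_isClosedUnderFiniteProducts _
  have : (P.map Bounded.ι).IsStableUnderRetracts := map_ι_isStableUnderRetracts P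
  have : (P.map Bounded.ι).IsClosedUnderFiniteProducts := map_isClosedUnderFiniteProducts _ P
  obtain ⟨⟨a, _⟩, ⟨b, _⟩⟩ := M.property
  have h := extensionProductIter_map_le Bounded.ι P (d + 1) _
    (extensionProductIter_of_hasSyzygyIn hF (P.map Bounded.ι) (fun B n hB ↦ map_ι_single F B n hB)
      d M.obj a b hM)
  rw [ObjectProperty.prop_map_iff] at h
  obtain ⟨X, hX, ⟨e⟩⟩ := h
  have := addClosure_isStableUnderRetracts (P.extensionProductIter (d + 1))
  exact (addClosure (P.extensionProductIter (d + 1))).prop_of_iso (Bounded.ι.preimageIso (Y := M) e)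
    (le_addClosure _ _ hX)

end Transport
end ResolvingDim

theorem theorem1p3 (A : Type u) [Category.{v} A] [Abelian A] [EnoughProjectives A]
    [HasDerivedCategory.{w} A] (d : ℕ) :
    (∀ F : ObjectProperty A, ResolvingDim.IsResolving F →
      ∀ M : DerivedCategory.Bounded A,
        (∀ i : ℤ, ∃ X : A,
          ResolvingDim.IsSyzygy d ((ResolvingDim.cohomology A i).obj M) X ∧ F X) →
        ResolvingDim.level (F.map (ResolvingDim.single A)) (max 2 (d + 1)) M) ∧
    ResolvingDim.relDim
      ((ResolvingDim.res (ResolvingDim.syzygies d (⊤ : ObjectProperty A))).map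
        (ResolvingDim.single A)) ≤ ((max 1 d : ℕ) : ℕ∞) := by
  have level_of_isSyzygy (F : ObjectProperty A) (hF : ResolvingDim.IsResolving F)
      (M : DerivedCategory.Bounded A)
      (hM : ∀ i : ℤ, ResolvingDim.HasSyzygyIn F d ((ResolvingDim.cohomology A i).obj M)) :
      ResolvingDim.level (F.map (ResolvingDim.single A)) (max 2 (d + 1)) M := by
    cases d with
    -- Treated as `d = 1`, which is why the bound is never below `2`.
    | zero => exact ResolvingDim.level_of_hasSyzygyIn hF 0 M fun i ↦ (hM i).succ hF
    | succ d =>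
      rw [max_eq_right (by lia)]
      exact ResolvingDim.level_of_hasSyzygyIn hF d M hM
  refine ⟨level_of_isSyzygy, iInf₂_le (max 1 d) fun M ↦ ?_⟩
  rw [show max 1 d + 1 = max 2 (d + 1) by lia]
  refine level_of_isSyzygy _ (ResolvingDim.isResolving_res _) M fun i ↦ ?_
  obtain ⟨X, hX⟩ := ResolvingDim.HasSyzygyIn.exists_isSyzygy d ((ResolvingDim.cohomology A i).obj M)
  exact ⟨X, hX, ResolvingDim.le_res _ X ⟨_, trivial, hX⟩⟩
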